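/- Let $\mathcal C$ be a locally small cocomplete category and let $J$ be a (small) set of morphisms of $\mathcal C$. An \emph{algebraic $J$-injective} is an object $C\in\mathcal C$ together with a chosen morphism $c(j,f):B\to C$ satisfying $c(j,f)\circ j=f$ for every $j:A\to B$ in $J$ and every $f:A\to C$. A morphism $(C,c)\to(D,d)$ of algebraic $J$-injectives is a morphism $g:C\to D$ of $\mathcal C$ with $g\circ c(j,f)=d(j,g\circ f)$ for all $j:A\to B$ in $J$ and $f:A\to C$. Write $\mathbb{I}\mathrm{nj}(J)$ for the resulting category and $U:\mathbb{I}\mathrm{nj}(J)\to\mathcal C$, $(C,c)\mapsto C$, for the forgetful functor. Suppose that at least one of the following size conditions holds. (a) For each $X\in\mathcal C$ there is a regular cardinal $\alpha_X$ such that $\mathcal C(X,-)$ preserves $\alpha_X$-filtered colimits. (b) There is an orthogonal factorisation system $(\mathcal E,\mathcal M)$ on $\mathcal C$ which is proper (each morphism in $\mathcal E$ is an epimorphism and each morphism in $\mathcal M$ is a monomorphism) and well-copowered (each object has, up to isomorphism, only a set of $\mathcal E$-quotients), and for each $X\in\mathcal C$ there is a regular cardinal $\alpha_X$ such that $\mathcal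 C(X,-)$ preserves $\alpha_X$-filtered unions of $\mathcal M$-subobjects, that is, those small $\alpha_X$-filtered colimits whose colimit cocone consists of morphisms in $\mathcal M$. Then: (1) $U$ has a left adjoint and is strictly monadic, i.e. for any left adjoint the comparison functor from $\mathbb{I}\mathrm{nj}(J)$ to the category of algebras for the induced monad on $\mathcal C$ is an isomorphism of categories. (2) If moreover $\mathcal C$ is locally presentable, then $\mathbb{I}\mathrm{nj}(J)$ is locally presentable and $U$ is accessible, i.e. preserves $\kappa$-filtered colimits for some regular cardinal $\kappa$. -/

import Mathlib

open CategoryTheory CategoryTheory.Limits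

universe v u v₁ v₂ u₁ u₂

/-- An algebraic injective for a class `J` of morphisms of `C`: an object together with a chosen
extension along every `j : A ⟶ B` in `J` of every morphism `f : A ⟶ obj`. -/
structure AlgInj {C : Type u} [Category.{v} C] (J : MorphismProperty C) where
  /-- the underlying object -/
  obj : C
  /-- the chosen extensions -/
  lift : ∀ {A B : C} (j : A ⟶ B), J j → (A ⟶ obj) → (B ⟶ obj)
  fac : ∀ {A B : C} (j : A ⟶ B) (hj : J j) (f : A ⟶ obj), j ≫ lift j hj f = f

namespace AlgInj

variable {C : Type u} [Category.{v} C] {J : MorphismProperty C}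

/-- A morphism of algebraic injectives: a morphism of underlying objects commuting with the
chosen extensions. -/
@[ext]
structure Hom (X Y : AlgInj J) where
  /-- the underlying morphism -/
  hom : X.obj ⟶ Y.obj
  comm : ∀ {A B : C} (j : A ⟶ B) (hj : J j) (f : A ⟶ X.obj),
    X.lift j hj f ≫ hom = Y.lift j hj (f ≫ hom)

/-- The category of algebraic injectives. -/
instance : Category.{v} (AlgInj J) where
  Hom X Y := Hom X Y
  id X := { hom := 𝟙 X.obj, comm := by simp }
  comp f g :=
    { hom := f.hom ≫ g.hom
      comm := fun j hj k => by
        rw [← Category.assoc, f.comm, g.comm, Category.assoc] }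
  id_comp f := Hom.ext (Category.id_comp f.hom)
  comp_id f := Hom.ext (Category.comp_id f.hom)
  assoc f g h := Hom.ext (Category.assoc f.hom g.hom h.hom)

/-- The forgetful functor from algebraic injectives to `C`. -/
def forget (J : MorphismProperty C) : AlgInj J ⥤ C where
  obj X := X.obj
  map f := Hom.hom f
  map_id _ := rfl
  map_comp _ _ := rfl

end AlgInj

/-- A functor is an isomorphism of categories if it has a two-sided inverse on the nose. -/
def IsCategoryIso {A : Type u₁} [Category.{v₁} A] {B : Type u₂} [Category.{v₂} B]
    (F : A ⥤ B) : Prop :=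
  ∃ G : B ⥤ A, F ⋙ G = 𝟭 A ∧ G ⋙ F = 𝟭 B

/-- `U` is strictly monadic if it has a left adjoint and, for each adjunction `L ⊣ U`, the
Eilenberg-Moore comparison functor to the algebras of the induced monad is an isomorphism
of categories. -/
def IsStrictlyMonadic {A : Type u₁} [Category.{v₁} A] {B : Type u₂} [Category.{v₂} B]
    (U : A ⥤ B) : Prop :=
  U.IsRightAdjoint ∧ ∀ (L : B ⥤ A) (adj : L ⊣ U), IsCategoryIso (Monad.comparison adj)

section FactorisationSystems

variable {C : Type u} [Category.{v} C]

/-- An (orthogonal) factorisation system: both classes are closed under isomorphism, each morphism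
is a morphism of `E` followed by one of `M`, and the unique diagonal fill-in property holds. -/
structure IsFactorisationSystem (E M : MorphismProperty C) : Prop where
  left_respectsIso : E.RespectsIso
  right_respectsIso : M.RespectsIso
  factor : ∀ {X Y : C} (f : X ⟶ Y), ∃ (Z : C) (e : X ⟶ Z) (m : Z ⟶ Y), E e ∧ M m ∧ e ≫ m = f
  diagonal : ∀ {A B X Y : C} (e : A ⟶ B) (m : X ⟶ Y), E e → M m →
    ∀ (f : A ⟶ X) (g : B ⟶ Y), f ≫ m = e ≫ g → ∃! d : B ⟶ X, e ≫ d = f ∧ d ≫ m = g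

/-- A factorisation system is proper if `E` consists of epimorphisms and `M` of monomorphisms. -/
def IsProperPair (E M : MorphismProperty C) : Prop :=
  (∀ {X Y : C} (e : X ⟶ Y), E e → Epi e) ∧ (∀ {X Y : C} (m : X ⟶ Y), M m → Mono m)

/-- Well-copoweredness: each object has, up to isomorphism, only a small set of `E`-quotients. -/
def IsWellCopowered (E : MorphismProperty C) : Prop :=
  ∀ X : C, ∃ (ι : Type v) (Y : ι → C) (q : ∀ i, X ⟶ Y i), (∀ i, E (q i)) ∧
    ∀ {Z : C} (e : X ⟶ Z), E e → ∃ (i : ι) (φ : Y i ≅ Z), q i ≫ φ.hom = e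

/-- The functor `C(X, -)` preserves `κ`-filtered unions of `M`-subobjects, i.e. those small
`κ`-filtered colimits whose colimit cocone consists of morphisms in `M`, so that they exhibit the
colimit as the union of the `M`-subobjects given by the cocone. -/
def HomPreservesUnions (M : MorphismProperty C) (X : C) (κ : Cardinal.{v})
    [Fact κ.IsRegular] : Prop :=
  ∀ (K : Type v) [SmallCategory K] [IsCardinalFiltered K κ] (F : K ⥤ C) (c : Cocone F),
    (∀ k : K, M (c.ι.app k)) → Nonempty (IsColimit c) →
      Nonempty (IsColimit ((coyoneda.obj (Opposite.op X)).mapCocone c))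

end FactorisationSystems

/-- For each object `X` there is a regular cardinal `κ` such that `C(X, -)` preserves
`κ`-filtered colimits. -/
def PresentableSizeCondition (C : Type u) [Category.{v} C] : Prop :=
  ∀ X : C, ∃ (κ : Cardinal.{v}) (_ : Fact κ.IsRegular),
    (coyoneda.obj (Opposite.op X)).IsCardinalAccessible κ

/-- There is a proper well-copowered factorisation system `(E, M)` such that for each object `X`
there is a regular cardinal `κ` such that `C(X, -)` preserves `κ`-filtered unions of
`M`-subobjects. -/
def BoundedSizeCondition (C : Type u) [Category.{v} C] : Prop :=
  ∃ E M : MorphismProperty C, IsFactorisationSystem E M ∧ IsProperPair E M ∧ IsWellCopowered E ∧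
    ∀ X : C, ∃ (κ : Cardinal.{v}) (_ : Fact κ.IsRegular), HomPreservesUnions M X κ

/-!
The idea is to present algebraic injectives as the objects orthogonal to a set of morphisms in a
larger cocomplete category, and to construct their reflection there by a transfinite iteration.

A *partial* algebraic injective (`PartInj`) is an object of `C` with, for each `j : A ⟶ B` in `J`,
an arbitrary set of distinguished morphisms out of `B`. The category of these has colimits, computed
in `C`: a morphism into the colimit is distinguished if it comes from a distinguished one at some
stage. An extension along `j` determines the morphism it extends, so algebraic injectives are
precisely those partial ones for which each `f : A ⟶ X` has exactly one distinguished extension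
along each `j`. By `PartInj.isLocal_genericArrows_iff` this is orthogonality to the morphism
`PartInj.toGeneric j` from `A` without distinguished morphisms to `B` with the identity
distinguished, and `AlgInj.toPartInj` identifies `AlgInj J` with the full subcategory of local
objects. The forgetful functor from `PartInj J` has the left adjoint `PartInj.discrete`, so the left
adjoint of `AlgInj.forget J` exists once local objects are reflective.

The reflection iterates a step which freely adds extensions and identifies competing ones. This
converges after `κ` steps as soon as morphisms from each `A` to the colimit of the iteration factor
essentially uniquely through a stage
(`OrthogonalReflectionWithPreparation.isRightAdjoint_ι`). If the functors `C(A, -)` preserve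
`κ`-filtered colimits there is nothing more to do. For a factorisation system `(E, M)`, each step is
preceded by a preparation (`PartInj.exists_preparation`): by well-copoweredness, a wide pushout of a
set of extensions of `Z` factors through all the `E`-quotients of `Z` which any extension may ever
induce. Consequently the images of the stages in the colimit are interleaved with the stages
themselves. The colimit is thus the union of these `M`-subobjects, and preservation of unions gives
the factorisation property (`FactorsThroughStages.of_homPreservesUnions`).

Strict monadicity is direct: an algebra `(X, a)` for the monad carries the extensions
`lift (f ≫ η) ≫ a`, where `lift` is taken in the free algebraic injective on `X`
(`AlgInj.ofAlgebra`), and this is inverse to the comparison functor.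

If `C` is locally presentable and `κ` is large, local objects are closed under `κ`-filtered
colimits, so `AlgInj.forget J` is `κ`-accessible. As `AlgInj J` is reflective in `PartInj J` it is
cocomplete, and the free algebraic injectives on a strong generator of `C` form a strong generator
of `κ`-presentable objects.
-/

/-! ### Partial algebraic injectives -/

/-- A partial algebraic injective: an object together with, for each `j : A ⟶ B` in `J`, a set of
distinguished morphisms out of `B`. A distinguished `c : B ⟶ obj` is thought of as a chosen
extension of `j ≫ c` along `j`; there may be none or several for a given morphism `A ⟶ obj`. -/
structure PartInj {C : Type u} [Category.{v} C] (J : MorphismProperty C) where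
  /-- the underlying object -/
  obj : C
  /-- the distinguished morphisms -/
  dist : ∀ {A B : C} (j : A ⟶ B), J j → Set (B ⟶ obj)

namespace PartInj

variable {C : Type u} [Category.{v} C] {J : MorphismProperty C}

/-- A morphism of partial algebraic injectives: a morphism of underlying objects which preserves
distinguished morphisms. -/
@[ext]
structure Hom (X Y : PartInj J) where
  /-- the underlying morphism -/
  hom : X.obj ⟶ Y.obj
  map_dist : ∀ {A B : C} (j : A ⟶ B) (hj : J j) (c : B ⟶ X.obj),
    c ∈ X.dist j hj → c ≫ hom ∈ Y.dist j hj

instance : Category.{v} (PartInj J) where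
  Hom X Y := Hom X Y
  id X := { hom := 𝟙 X.obj, map_dist := by simp }
  comp f g :=
    { hom := f.hom ≫ g.hom
      map_dist := fun j hj c hc => by
        rw [← Category.assoc]
        exact g.map_dist j hj _ (f.map_dist j hj c hc) }
  id_comp f := Hom.ext (Category.id_comp f.hom)
  comp_id f := Hom.ext (Category.comp_id f.hom)
  assoc f g h := Hom.ext (Category.assoc f.hom g.hom h.hom)

@[simp] lemma comp_hom {X Y Z : PartInj J} (f : X ⟶ Y) (g : Y ⟶ Z) :
    Hom.hom (f ≫ g) = Hom.hom f ≫ Hom.hom g := rfl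

@[ext] lemma hom_ext {X Y : PartInj J} {f g : X ⟶ Y} (h : Hom.hom f = Hom.hom g) : f = g :=
  Hom.ext h

variable (J) in
/-- The forgetful functor from partial algebraic injectives. -/
@[simps]
def forget : PartInj J ⥤ C where
  obj X := X.obj
  map f := Hom.hom f

variable (J) in
/-- The partial algebraic injective without distinguished morphisms on a given object. -/
@[simps]
def discrete : C ⥤ PartInj J where
  obj X := { obj := X, dist := fun _ _ => ∅ }
  map f := { hom := f, map_dist := by simp }

variable (J) in
/-- The partial algebraic injective on a given object in which every morphism is distinguished. -/
@[simps]
def codiscrete : C ⥤ PartInj J where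
  obj X := { obj := X, dist := fun _ _ => Set.univ }
  map f := { hom := f, map_dist := by simp }

variable (J) in
/-- `discrete` is left adjoint to the forgetful functor. -/
def discreteAdj : discrete J ⊣ forget J :=
  Adjunction.mkOfHomEquiv
    { homEquiv := fun _ _ =>
        { toFun := fun f => Hom.hom f
          invFun := fun f => { hom := f, map_dist := fun _ _ _ hc => hc.elim }
          left_inv := fun _ => rfl
          right_inv := fun _ => rfl } }

variable (J) in
/-- `codiscrete` is right adjoint to the forgetful functor. -/
def codiscreteAdj : forget J ⊣ codiscrete J :=
  Adjunction.mkOfHomEquiv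
    { homEquiv := fun _ _ =>
        { toFun := fun f => { hom := f, map_dist := fun _ _ _ _ => Set.mem_univ _ }
          invFun := fun f => Hom.hom f
          left_inv := fun _ => rfl
          right_inv := fun _ => rfl } }

instance : (forget J).IsRightAdjoint := (discreteAdj J).isRightAdjoint

instance : (forget J).IsLeftAdjoint := (codiscreteAdj J).isLeftAdjoint

section Colimits

variable {K : Type u₁} [Category.{v₁} K] (F : K ⥤ PartInj J)

/-- A cocone on the underlying diagram lifts to partial algebraic injectives: the distinguished
morphisms are those which come from some stage of the diagram. -/
@[simps]
def liftCocone (c : Cocone (F ⋙ forget J)) : Cocone F where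
  pt :=
    { obj := c.pt
      dist := fun j hj => {b | ∃ (k : K) (b' : _ ⟶ (F.obj k).obj), b' ∈ (F.obj k).dist j hj ∧
        b' ≫ c.ι.app k = b} }
  ι :=
    { app := fun k =>
        { hom := c.ι.app k
          map_dist := fun _ _ b hb => ⟨k, b, hb, rfl⟩ }
      naturality := fun _ _ f => hom_ext (c.ι.naturality f) }

/-- The lift of a colimit cocone is a colimit cocone. -/
def isColimitLiftCocone {c : Cocone (F ⋙ forget J)} (hc : IsColimit c) :
    IsColimit (liftCocone F c) where
  desc s :=
    { hom := hc.desc ((forget J).mapCocone s)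
      map_dist := by
        rintro A B j hj _ ⟨k, b, hb, rfl⟩
        have h : b ≫ c.ι.app k ≫ hc.desc ((forget J).mapCocone s) = b ≫ Hom.hom (s.ι.app k) :=
          congrArg (b ≫ ·) (hc.fac ((forget J).mapCocone s) k)
        exact Set.mem_of_eq_of_mem ((Category.assoc _ _ _).trans h)
          ((s.ι.app k).map_dist j hj b hb) }
  fac s k := hom_ext (hc.fac ((forget J).mapCocone s) k)
  uniq s m hm := hom_ext (hc.uniq ((forget J).mapCocone s) (Hom.hom m)
    (fun k => congrArg Hom.hom (hm k)))

instance [HasColimitsOfShape K C] : HasColimitsOfShape K (PartInj J) where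
  has_colimit F := ⟨⟨⟨_, isColimitLiftCocone F (colimit.isColimit (F ⋙ forget J))⟩⟩⟩

instance [HasColimitsOfSize.{v₁, u₁} C] : HasColimitsOfSize.{v₁, u₁} (PartInj J) where

variable {F} in
/-- A distinguished morphism into a colimit comes from some stage of the diagram. -/
lemma exists_dist_of_isColimit {c : Cocone F} (hc : IsColimit c) {A B : C} {j : A ⟶ B} {hj : J j}
    {b : B ⟶ c.pt.obj} (hb : b ∈ c.pt.dist j hj) :
    ∃ (k : K) (b' : B ⟶ (F.obj k).obj), b' ∈ (F.obj k).dist j hj ∧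
      b' ≫ Hom.hom (c.ι.app k) = b := by
  obtain ⟨k, b', hb', h⟩ :=
    (hc.desc (liftCocone F ((forget J).mapCocone c))).map_dist j hj b hb
  refine ⟨k, b', hb', ?_⟩
  have e : Hom.hom (hc.desc (liftCocone F ((forget J).mapCocone c))) = 𝟙 c.pt.obj :=
    (isColimitOfPreserves (forget J) hc).hom_ext (fun k => by
      have := congrArg Hom.hom (hc.fac (liftCocone F ((forget J).mapCocone c)) k)
      exact this.trans (Category.comp_id _).symm)
  rw [e] at h
  exact h.trans (Category.comp_id _)

end Colimits

/-- The partial algebraic injective on the codomain of `j` whose only distinguished morphism is the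
identity, as an extension along `j`. It corepresents the distinguished morphisms for `j`. The
equality of arrows in the definition says that the index `j'` is `j`. -/
@[simps]
def generic {A B : C} (j : A ⟶ B) (_ : J j) : PartInj J where
  obj := B
  dist j' _ := {c | ∃ (h : Arrow.mk j' = Arrow.mk j), c = eqToHom (congrArg Comma.right h)}

/-- The morphism out of `generic j hj` given by a distinguished morphism. -/
@[simps]
def genericDesc {A B : C} {j : A ⟶ B} {hj : J j} {X : PartInj J} (c : B ⟶ X.obj)
    (hc : c ∈ X.dist j hj) : generic j hj ⟶ X where
  hom := c
  map_dist := by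
    rintro A' B' j' hj' _ ⟨h, rfl⟩
    obtain rfl : A' = A := congrArg Comma.left h
    obtain rfl : B' = B := congrArg Comma.right h
    obtain rfl : j' = j := (Arrow.mk_inj _ _).1 h
    exact (Category.id_comp c).symm ▸ hc

lemma hom_mem_dist_of_generic {A B : C} {j : A ⟶ B} {hj : J j} {X : PartInj J}
    (f : generic j hj ⟶ X) : Hom.hom f ∈ X.dist j hj := by
  have h := f.map_dist j hj (𝟙 B) ⟨rfl, rfl⟩
  have e : 𝟙 B ≫ Hom.hom f = Hom.hom f := Category.id_comp (Hom.hom f)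
  exact e ▸ h

/-- The morphism with underlying morphism `j`. An object is orthogonal to it if each morphism from
the domain of `j` has exactly one distinguished extension along `j`. -/
@[simps]
def toGeneric {A B : C} (j : A ⟶ B) (hj : J j) : (discrete J).obj A ⟶ generic j hj where
  hom := j
  map_dist := fun _ _ _ hc => hc.elim

variable (J) in
/-- The class of all morphisms `toGeneric j hj`. Its local objects are the algebraic injectives. -/
def genericArrows : MorphismProperty (PartInj J) :=
  MorphismProperty.ofHoms (fun (j : J.toSet) => toGeneric j.1.hom j.2)

lemma genericArrows_toGeneric {A B : C} (j : A ⟶ B) (hj : J j) :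
    genericArrows J (toGeneric j hj) :=
  MorphismProperty.ofHoms.mk (f := fun (j : J.toSet) => toGeneric j.1.hom j.2) ⟨Arrow.mk j, hj⟩

instance [MorphismProperty.IsSmall.{v₁} J] : MorphismProperty.IsSmall.{v₁} (genericArrows J) := by
  dsimp only [genericArrows]
  infer_instance

lemma isLocal_genericArrows_iff (X : PartInj J) :
    (genericArrows J).isLocal X ↔ ∀ {A B : C} (j : A ⟶ B) (hj : J j) (f : A ⟶ X.obj),
      ∃! c : B ⟶ X.obj, c ∈ X.dist j hj ∧ j ≫ c = f := by
  constructor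
  · intro h A B j hj f
    have h' := h _ (genericArrows_toGeneric j hj)
    obtain ⟨g, hg⟩ := h'.2 { hom := f, map_dist := fun _ _ _ hc => hc.elim }
    refine ⟨Hom.hom g, ⟨hom_mem_dist_of_generic g, congrArg Hom.hom hg⟩, ?_⟩
    rintro c ⟨hc, hc'⟩
    have : genericDesc c hc = g := h'.1 (hom_ext (hc'.trans (congrArg Hom.hom hg).symm))
    exact congrArg Hom.hom this
  · rintro h _ _ _ ⟨⟨⟨A, B, j⟩, hj⟩⟩
    refine ⟨fun g g' e => hom_ext ?_, fun f => ?_⟩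
    · exact (h j hj (j ≫ Hom.hom g)).unique ⟨hom_mem_dist_of_generic g, rfl⟩
        ⟨hom_mem_dist_of_generic g', (congrArg Hom.hom e).symm⟩
    · obtain ⟨c, hc, hc'⟩ := (h j hj (Hom.hom f)).exists
      exact ⟨genericDesc c hc, hom_ext hc'⟩

end PartInj

namespace AlgInj

variable {C : Type u} [Category.{v} C] {J : MorphismProperty C}

@[ext] lemma hom_ext {X Y : AlgInj J} {f g : X ⟶ Y} (h : Hom.hom f = Hom.hom g) : f = g :=
  Hom.ext h

variable (J) in
/-- An algebraic injective as a partial one: the distinguished morphisms are the chosen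
extensions. -/
@[simps]
def toPartInj : AlgInj J ⥤ PartInj J where
  obj X :=
    { obj := X.obj
      dist := fun j hj => Set.range (X.lift j hj) }
  map f :=
    { hom := Hom.hom f
      map_dist := by
        rintro A B j hj _ ⟨a, rfl⟩
        exact ⟨_, (f.comm j hj a).symm⟩ }

instance : (toPartInj J).Faithful where
  map_injective h := hom_ext (congrArg PartInj.Hom.hom h)

/-- A chosen extension of `f` along `j` determines `f`, so a morphism preserving distinguished
morphisms preserves the chosen extensions. -/
instance : (toPartInj J).Full where
  map_surjective {X Y} f := ⟨
    { hom := PartInj.Hom.hom f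
      comm := fun j hj a => by
        obtain ⟨b, hb⟩ := f.map_dist j hj (X.lift j hj a) ⟨a, rfl⟩
        have h₁ : j ≫ Y.lift j hj b = (j ≫ X.lift j hj a) ≫ PartInj.Hom.hom f :=
          (congrArg (j ≫ ·) hb).trans (Category.assoc _ _ _).symm
        rw [Y.fac, X.fac] at h₁
        exact hb.symm.trans (congrArg (Y.lift j hj) h₁) }, rfl⟩

lemma isLocal_toPartInj_obj (X : AlgInj J) :
    (PartInj.genericArrows J).isLocal ((toPartInj J).obj X) := by
  rw [PartInj.isLocal_genericArrows_iff]
  intro A B j hj f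
  refine ⟨X.lift j hj f, ⟨⟨f, rfl⟩, X.fac j hj f⟩, ?_⟩
  rintro _ ⟨⟨g, rfl⟩, hc⟩
  exact congrArg (X.lift j hj) ((X.fac j hj g).symm.trans hc)

variable (J) in
/-- Algebraic injectives, as local partial algebraic injectives. -/
def toLocal : AlgInj J ⥤ (PartInj.genericArrows J).isLocal.FullSubcategory :=
  ObjectProperty.lift _ (toPartInj J) isLocal_toPartInj_obj

instance : (toLocal J).Faithful := by dsimp only [toLocal]; infer_instance

instance : (toLocal J).Full := by dsimp only [toLocal]; infer_instance

instance : (toLocal J).EssSurj where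
  mem_essImage X := by
    have hX := @(PartInj.isLocal_genericArrows_iff X.obj).1 X.property
    choose l hl hl' using fun {A B : C} (j : A ⟶ B) (hj : J j) (f : A ⟶ X.obj.obj) =>
      (hX j hj f).exists
    let Y : AlgInj J :=
      { obj := X.obj.obj
        lift := fun j hj f => l j hj f
        fac := fun j hj f => hl' j hj f }
    have hY : ∀ {A B : C} (j : A ⟶ B) (hj : J j) (c : B ⟶ X.obj.obj),
        c ∈ ((toPartInj J).obj Y).dist j hj ↔ c ∈ X.obj.dist j hj := by
      intro A B j hj c
      constructor
      · rintro ⟨f, rfl⟩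
        exact (hl j hj f)
      · intro hc
        exact ⟨j ≫ c, (hX j hj (j ≫ c)).unique ⟨hl j hj _, hl' j hj _⟩ ⟨hc, rfl⟩⟩
    refine ⟨Y, ⟨ObjectProperty.isoMk _
      { hom := { hom := 𝟙 X.obj.obj, map_dist := fun j hj c hc => ?_ }
        inv := { hom := 𝟙 X.obj.obj, map_dist := fun j hj c hc => ?_ }
        hom_inv_id := PartInj.hom_ext (Category.id_comp _)
        inv_hom_id := PartInj.hom_ext (Category.id_comp _) }⟩⟩
    · exact Set.mem_of_eq_of_mem (Category.comp_id _) ((hY j hj c).1 hc)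
    · exact Set.mem_of_eq_of_mem (Category.comp_id _) ((hY j hj c).2 hc)

instance : (toLocal J).IsEquivalence where

end AlgInj

/-! ### Orthogonal reflection with a preparation before each step -/

namespace OrthogonalReflectionWithPreparation

open OrthogonalReflection SmallObject

variable {C : Type u} [Category.{v} C] [HasColimitsOfSize.{v, v} C] (W : MorphismProperty C)
  [MorphismProperty.IsSmall.{v} W] (prep : C → C) (toPrep : ∀ Z, Z ⟶ prep Z)

attribute [local instance] D₁.hasCoproductsOfShape D₂.hasColimitsOfShape

/-- The successor structure which sends `Z` to one step `succ W (prep Z)` of the orthogonal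
reflection construction, applied after a preparation `toPrep Z : Z ⟶ prep Z`. -/
noncomputable def succStruct (Z₀ : C) : SuccStruct C where
  X₀ := Z₀
  succ Z := succ W (prep Z)
  toSucc Z := toPrep Z ≫ toSucc W (prep Z)

variable {prep} (hprep : ∀ Z, W.isLocal.isLocal (toPrep Z)) (κ : Cardinal.{v}) [Fact κ.IsRegular]

/-- The smallness condition for a cocone `c` under a diagram `F`, to be used for colimits: morphisms
from domains of `W` to the point of `c` factor essentially uniquely through a stage, and
morphisms from codomains factor through a stage. -/
structure IsSmallFor {K : Type u₁} [Category.{v₁} K] (F : K ⥤ C) (c : Cocone F) : Prop where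
  exists_left : ∀ {X Y : C} (f : X ⟶ Y), W f → ∀ g : X ⟶ c.pt,
    ∃ (k : K) (g' : X ⟶ F.obj k), g' ≫ c.ι.app k = g
  eq_left : ∀ {X Y : C} (f : X ⟶ Y), W f → ∀ (k : K) (g g' : X ⟶ F.obj k),
    g ≫ c.ι.app k = g' ≫ c.ι.app k → ∃ (l : K) (u : k ⟶ l), g ≫ F.map u = g' ≫ F.map u
  exists_right : ∀ {X Y : C} (f : X ⟶ Y), W f → ∀ g : Y ⟶ c.pt,
    ∃ (k : K) (g' : Y ⟶ F.obj k), g' ≫ c.ι.app k = g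

omit [HasColimitsOfSize.{v, v} C] [MorphismProperty.IsSmall.{v} W] in
/-- Local objects are closed under those filtered colimits for which `W` is small in the sense of
`IsSmallFor`. -/
lemma IsSmallFor.isLocal_pt {K : Type u₁} [Category.{v₁} K] [IsFiltered K] {F : K ⥤ C}
    {c : Cocone F} (hS : IsSmallFor W F c) (hF : ∀ k, W.isLocal (F.obj k)) : W.isLocal c.pt := by
  intro X Y f hf
  refine ⟨fun g₁ g₂ h => ?_, fun g => ?_⟩
  · obtain ⟨j₁, g₁, rfl⟩ := hS.exists_right f hf g₁
    obtain ⟨j₂, g₂, rfl⟩ := hS.exists_right f hf g₂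
    obtain ⟨j, u₁, u₂, -⟩ := IsFilteredOrEmpty.cocone_objs j₁ j₂
    dsimp at h ⊢
    rw [← c.w u₁, ← c.w u₂] at h ⊢
    obtain ⟨k, u, hk⟩ := hS.eq_left f hf j (f ≫ g₁ ≫ F.map u₁) (f ≫ g₂ ≫ F.map u₂)
      (by simpa using h)
    have hg := (hF k f hf).1 (a₁ := (g₁ ≫ F.map u₁) ≫ F.map u) (a₂ := (g₂ ≫ F.map u₂) ≫ F.map u)
      (by simpa using hk)
    simpa using congrArg (· ≫ c.ι.app k) hg
  · obtain ⟨j, g, rfl⟩ := hS.exists_left f hf g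
    obtain ⟨g', rfl⟩ := (hF j f hf).2 g
    exact ⟨g' ≫ c.ι.app j, by simp⟩

variable (hsmall : ∀ (F : κ.ord.ToType ⥤ C) (c : Cocone F), IsColimit c →
  (∀ k, W.isLocal.isLocal (c.ι.app k)) →
  (∀ k, ∃ (l : κ.ord.ToType) (u : k ⟶ l) (g : prep (F.obj k) ⟶ F.obj l),
    toPrep _ ≫ g = F.map u) → IsSmallFor W F c)

include hprep hsmall in
/-- The colimit of the transfinite iteration of `succStruct` is local, and the morphism to it is
inverted by all local objects. -/
lemma exists_reflection (Z : C) :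
    ∃ (Z' : C) (r : Z ⟶ Z'), W.isLocal Z' ∧ W.isLocal.isLocal r := by
  have : Nonempty κ.ord.ToType := by simpa using Cardinal.IsRegular.ne_zero Fact.out
  have := WellFoundedLT.toOrderBot κ.ord.ToType
  have := Cardinal.noMaxOrder (Fact.elim inferInstance : κ.IsRegular).aleph0_le
  let Φ := succStruct W prep toPrep Z
  have hΦ : Φ.prop ≤ W.isLocal.isLocal := by
    rintro Z₀ _ _ ⟨_⟩
    exact W.isLocal.isLocal.comp_mem _ _ (hprep Z₀) (isLocal_isLocal_toSucc W _)
  let H := (Φ.transfiniteCompositionOfShapeιIteration κ.ord.ToType).ofLE hΦ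
  have hsucc (j : κ.ord.ToType) : ∃ e : H.F.obj (Order.succ j) ≅ succ W (prep (H.F.obj j)),
      H.F.map (homOfLE (Order.le_succ j)) = (toPrep _ ≫ toSucc W _) ≫ e.inv :=
    ⟨Φ.iterationFunctorObjSuccIso j (not_isMax j), Φ.iterationFunctor_map_succ j (not_isMax j)⟩
  choose e he using hsucc
  let c : Cocone H.F := ⟨_, H.incl⟩
  have hc : IsColimit c := H.isColimit
  have hcW (k) : W.isLocal.isLocal (c.ι.app k) := H.mem_incl_app k
  have hS : IsSmallFor W H.F c := hsmall H.F c hc hcW (fun k =>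
    ⟨_, homOfLE (Order.le_succ k), toSucc W _ ≫ (e k).inv, by simp only [he, Category.assoc]⟩)
  refine ⟨_, _, ?_, W.isLocal.isLocal.transfiniteCompositionsOfShape_le κ.ord.ToType _ ⟨H⟩⟩
  intro X Y f hf
  refine ⟨fun g₁ g₂ h => ?_, fun g => ?_⟩
  · obtain ⟨j₁, g₁, rfl⟩ := hS.exists_right f hf g₁
    obtain ⟨j₂, g₂, rfl⟩ := hS.exists_right f hf g₂
    obtain ⟨j, u₁, u₂, -⟩ : ∃ (j : κ.ord.ToType) (_ : j₁ ⟶ j) (_ : j₂ ⟶ j), True :=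
      ⟨max j₁ j₂, homOfLE (le_max_left _ _), homOfLE (le_max_right _ _), trivial⟩
    rw [← c.w u₁, ← c.w u₂] at h ⊢
    -- The restrictions along `f` agree at the stage `k`, so `g₁` and `g₂` agree one step later.
    obtain ⟨k, u, hk⟩ := hS.eq_left f hf j (f ≫ g₁ ≫ H.F.map u₁) (f ≫ g₂ ≫ H.F.map u₂)
      (by simpa using h)
    have hg := toSucc_injectivity f hf
      ((g₁ ≫ H.F.map u₁) ≫ H.F.map u ≫ toPrep _) ((g₂ ≫ H.F.map u₂) ≫ H.F.map u ≫ toPrep _)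
      (by simpa using congrArg (· ≫ toPrep _) hk)
    have hg' : ((g₁ ≫ H.F.map u₁) ≫ H.F.map u) ≫ H.F.map (homOfLE (Order.le_succ k)) =
        ((g₂ ≫ H.F.map u₂) ≫ H.F.map u) ≫ H.F.map (homOfLE (Order.le_succ k)) := by
      rw [he]
      simpa using congrArg (· ≫ (e k).inv) hg
    have := congrArg (· ≫ c.ι.app _) hg'
    simpa using this
  · obtain ⟨j, g, rfl⟩ := hS.exists_left f hf g
    obtain ⟨g', hg'⟩ := toSucc_surjectivity f hf (g ≫ toPrep _)
    refine ⟨(g' ≫ (e j).inv) ≫ c.ι.app (Order.succ j), ?_⟩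
    have : f ≫ g' ≫ (e j).inv = g ≫ H.F.map (homOfLE (Order.le_succ j)) := by
      simp only [he, reassoc_of% hg', Category.assoc]
    simp only [← Category.assoc] at this ⊢
    rw [this, Category.assoc, c.w]

include hprep hsmall in
lemma isRightAdjoint_ι : W.isLocal.ι.IsRightAdjoint := by
  rw [Functor.isRightAdjoint_iff_leftAdjointObjIsDefined_eq_top]
  ext Z
  obtain ⟨Z', r, hZ', hr⟩ := exists_reflection W toPrep hprep κ hsmall Z
  have : (W.isLocal.ι ⋙ coyoneda.obj (.op Z)).CorepresentableBy
      (⟨Z', hZ'⟩ : W.isLocal.FullSubcategory) :=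
    { homEquiv := fun {A} => (ObjectProperty.fullyFaithfulι _).homEquiv.trans
        (Equiv.ofBijective _ (hr _ A.property))
      homEquiv_comp := fun f g => by
        simp [Functor.FullyFaithful.homEquiv] }
  simpa using! this.isCorepresentable

end OrthogonalReflectionWithPreparation

/-! ### Smallness conditions and reflectivity of algebraic injectives -/

/-- A small family of cardinals is bounded by a regular cardinal. -/
lemma exists_isRegular_forall_le {ι : Type u} [Small.{v} ι] (κ : ι → Cardinal.{v}) :
    ∃ κ' : Cardinal.{v}, κ'.IsRegular ∧ ∀ i, κ i ≤ κ' := by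
  have h : BddAbove (Set.range κ) := Cardinal.bddAbove_of_small
  refine ⟨Order.succ (max Cardinal.aleph0 (iSup κ)), Cardinal.isRegular_succ (le_max_left _ _),
    fun i => ?_⟩
  exact (le_ciSup h i).trans ((le_max_right _ _).trans (Order.le_succ _))

section Smallness

variable {C : Type u} [Category.{v} C]

/-- Morphisms from `A` to the point of `c` factor through a stage of the diagram, and two morphisms
to the same stage which agree in the point agree at a later stage. -/
structure FactorsThroughStages {K : Type u₁} [Category.{v₁} K] (F : K ⥤ C) (c : Cocone F)
    (A : C) : Prop where
  exists_fac : ∀ g : A ⟶ c.pt, ∃ (k : K) (g' : A ⟶ F.obj k), g' ≫ c.ι.app k = g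
  exists_eq : ∀ (k : K) (g g' : A ⟶ F.obj k), g ≫ c.ι.app k = g' ≫ c.ι.app k →
    ∃ (l : K) (u : k ⟶ l), g ≫ F.map u = g' ≫ F.map u

lemma FactorsThroughStages.of_isCardinalAccessible {K : Type v} [SmallCategory K]
    (κ : Cardinal.{v}) [Fact κ.IsRegular] [IsCardinalFiltered K κ] {F : K ⥤ C} {c : Cocone F}
    (hc : IsColimit c) (A : C) [(coyoneda.obj (Opposite.op A)).IsCardinalAccessible κ] :
    FactorsThroughStages F c A where
  exists_fac g := by
    have : IsCardinalPresentable A κ := by assumption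
    exact IsCardinalPresentable.exists_hom_of_isColimit κ hc g
  exists_eq k g g' h := by
    have : IsCardinalPresentable A κ := by assumption
    exact IsCardinalPresentable.exists_eq_of_isColimit' κ hc g g' h

lemma HomPreservesUnions.of_le {M : MorphismProperty C} {X : C} {κ κ' : Cardinal.{v}}
    [Fact κ.IsRegular] [Fact κ'.IsRegular] (h : HomPreservesUnions M X κ) (hκ : κ ≤ κ') :
    HomPreservesUnions M X κ' := fun K _ _ F c hM hc =>
  have := IsCardinalFiltered.of_le K hκ
  h K F c hM hc

/-- For each `k`, let some transition `F.obj k ⟶ F.obj l` factor through every `E`-quotient of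
`F.obj k` through which the cocone leg factors. Then the `(E, M)`-images `I k` of the legs are
interleaved with the diagram. Hence the colimit is the union of the `I k`, and morphisms out of `A`
factor through stages as soon as `Hom(A, -)` preserves this union. -/
lemma FactorsThroughStages.of_homPreservesUnions {E M : MorphismProperty C}
    (hEM : IsFactorisationSystem E M) (hp : IsProperPair E M)
    {K : Type v} [SmallCategory K]
    (κ : Cardinal.{v}) [Fact κ.IsRegular] [IsCardinalFiltered K κ] {F : K ⥤ C} {c : Cocone F}
    (hc : IsColimit c)
    (hF : ∀ k, ∃ (l : K) (u : k ⟶ l), ∀ {X : C} (e : F.obj k ⟶ X) (m : X ⟶ c.pt), E e →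
      e ≫ m = c.ι.app k → ∃ t : X ⟶ F.obj l, e ≫ t = F.map u)
    {A : C} (hA : HomPreservesUnions M A κ) :
    FactorsThroughStages F c A := by
  choose I e m he hm hem using fun k => hEM.factor (c.ι.app k)
  have epi_e (k) : Epi (e k) := hp.1 _ (he k)
  have mono_m (k) : Mono (m k) := hp.2 _ (hm k)
  have hd {k l : K} (u : k ⟶ l) : ∃ d : I k ⟶ I l, e k ≫ d = F.map u ≫ e l ∧ d ≫ m l = m k :=
    (hEM.diagonal (e k) (m l) (he k) (hm l) (F.map u ≫ e l) (m k)
      (by rw [Category.assoc, hem, hem, c.w])).exists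
  choose d hd₁ hd₂ using @hd
  let G : K ⥤ C :=
    { obj := I
      map := d
      map_id := fun k => by rw [← cancel_mono (m k), hd₂, Category.id_comp]
      map_comp := fun u v => by
        rw [← cancel_mono (m _), hd₂, Category.assoc, hd₂, hd₂] }
  let c' : Cocone G := ⟨c.pt, { app := m, naturality := fun k l u => by simp [G, hd₂] }⟩
  let π : F ⟶ G := { app := e, naturality := fun k l u => (hd₁ u).symm }
  -- As the `e k` are epimorphisms, cocones under `G` and under `F` with the same point correspond.
  have hc' : IsColimit c' :=
    { desc := fun s => hc.desc ((Cocone.precompose π).obj s)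
      fac := fun s k => by
        rw [← cancel_epi (e k), ← Category.assoc]
        have : e k ≫ c'.ι.app k = c.ι.app k := hem k
        rw [this, hc.fac]
        rfl
      uniq := fun s f hf => hc.hom_ext fun k => by
        rw [hc.fac, ← hem, Category.assoc]
        exact congrArg (e k ≫ ·) (hf k) }
  obtain ⟨hA'⟩ := hA K G c' hm ⟨hc'⟩
  choose l u hu using hF
  choose t ht using fun k => hu k (e k) (m k) (he k) (hem k)
  exact
    { exists_fac := fun g => by
        obtain ⟨k, g', hg'⟩ := Types.jointly_surjective_of_isColimit hA' g
        change g' ≫ m k = g at hg'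
        refine ⟨l k, g' ≫ t k, ?_⟩
        have : t k ≫ c.ι.app (l k) = m k := by
          rw [← cancel_epi (e k), reassoc_of% ht, c.w, hem]
        rw [Category.assoc, this, hg']
      exists_eq := fun k g g' h => by
        refine ⟨l k, u k, ?_⟩
        -- The legs `m k` are monomorphisms, so `g` and `g'` already agree in the image `I k`.
        rw [← hem, ← Category.assoc, ← Category.assoc, cancel_mono] at h
        rw [← ht, reassoc_of% h] }

end Smallness

/-- Morphisms with a common domain which are inverted by mapping into the objects satisfying `P`
have a common extension with the same property, namely their wide pushout. -/
lemma exists_isLocal_of_family {D : Type u₁} [Category.{v₁} D] [HasColimitsOfSize.{v, v} D]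
    (P : ObjectProperty D) {Z : D} {ι : Type v} {Y : ι → D} (w : ∀ i, Z ⟶ Y i)
    (hw : ∀ i, P.isLocal (w i)) :
    ∃ (Z' : D) (r : Z ⟶ Z'), P.isLocal r ∧ ∀ i, ∃ l : Y i ⟶ Z', w i ≫ l = r := by
  have : HasWidePushout Z Y w := inferInstanceAs (HasColimit _)
  refine ⟨widePushout Z Y w, WidePushout.head w, fun T hT => ⟨fun g g' h => ?_, fun g => ?_⟩,
    fun i => ⟨WidePushout.ι w i, WidePushout.arrow_ι w i⟩⟩
  · refine WidePushout.hom_ext w _ _ (fun i => (hw i T hT).1 ?_) h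
    simpa only [WidePushout.arrow_ι_assoc] using h
  · choose f hf using fun i => (hw i T hT).2 g
    exact ⟨WidePushout.desc g f hf, WidePushout.head_desc _ _ _ _⟩

namespace PartInj

open OrthogonalReflectionWithPreparation

variable {C : Type u} [Category.{v} C] {J : MorphismProperty C}

/-- Distinguished morphisms into a colimit come from a stage, so only the domains of the morphisms
in `J` impose a size condition. -/
lemma isSmallFor {K : Type u₁} [Category.{v₁} K] {F : K ⥤ PartInj J} {c : Cocone F}
    (hc : IsColimit c) (h : ∀ {A B : C} (j : A ⟶ B), J j →
      FactorsThroughStages (F ⋙ forget J) ((forget J).mapCocone c) A) :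
    IsSmallFor (genericArrows J) F c where
  exists_left := by
    rintro _ _ _ ⟨⟨⟨A, B, j⟩, hj⟩⟩ g
    obtain ⟨k, g', hg'⟩ := (h j hj).exists_fac (Hom.hom g)
    exact ⟨k, { hom := g', map_dist := fun _ _ _ hc => hc.elim }, hom_ext hg'⟩
  eq_left := by
    rintro _ _ _ ⟨⟨⟨A, B, j⟩, hj⟩⟩ k g g' hg
    obtain ⟨l, u, hu⟩ := (h j hj).exists_eq k (Hom.hom g) (Hom.hom g') (congrArg Hom.hom hg)
    exact ⟨l, u, hom_ext hu⟩
  exists_right := by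
    rintro _ _ _ ⟨⟨⟨A, B, j⟩, hj⟩⟩ g
    obtain ⟨k, b, hb, hb'⟩ := exists_dist_of_isColimit hc (hom_mem_dist_of_generic g)
    exact ⟨k, genericDesc b hb, hom_ext hb'⟩

variable [HasColimitsOfSize.{v, v} C]

lemma isRightAdjoint_ι_of_presentableSizeCondition
    [MorphismProperty.IsSmall.{v} J] (hC : PresentableSizeCondition C) :
    (genericArrows J).isLocal.ι.IsRightAdjoint := by
  choose κ hκ hκ' using hC
  obtain ⟨κ', h, hle⟩ := exists_isRegular_forall_le (fun j : J.toSet => κ j.1.left)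
  have : Fact κ'.IsRegular := ⟨h⟩
  refine OrthogonalReflectionWithPreparation.isRightAdjoint_ι _ (fun Z => 𝟙 Z)
    (fun Z => MorphismProperty.id_mem _ _) κ' (fun F c hc _ _ => isSmallFor hc ?_)
  intro A B j hj
  have hA : κ A ≤ κ' := hle ⟨Arrow.mk j, hj⟩
  have := hκ' A
  have := (coyoneda.obj (Opposite.op A)).isCardinalAccessible_of_le hA
  exact .of_isCardinalAccessible κ' (isColimitOfPreserves (forget J) hc) A

/-- Every partial algebraic injective `Z` has an extension `r`, inverted by mapping into local
objects, which factors through each `E`-quotient of `Z` arising from any other such extension.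
Well-copoweredness leaves only a set of quotients to take care of, and one extension for each of
them is enough. -/
lemma exists_preparation {E : MorphismProperty C} (hE : IsWellCopowered E) (Z : PartInj J) :
    ∃ (Z' : PartInj J) (r : Z ⟶ Z'), (genericArrows J).isLocal.isLocal r ∧
      ∀ {Z'' : PartInj J} (w : Z ⟶ Z''), (genericArrows J).isLocal.isLocal w →
        ∀ {X : C} (e : Z.obj ⟶ X) (m : X ⟶ Z''.obj), E e → e ≫ m = Hom.hom w →
          ∃ t : X ⟶ Z'.obj, e ≫ t = Hom.hom r := by
  obtain ⟨ι, Y, q, -, hY⟩ := hE Z.obj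
  let S : Set ι := {i | ∃ (Z'' : PartInj J) (w : Z ⟶ Z'') (m : Y i ⟶ Z''.obj),
    (genericArrows J).isLocal.isLocal w ∧ q i ≫ m = Hom.hom w}
  choose Z'' w m hw hm using fun i : S => i.2
  obtain ⟨Z', r, hr, hl⟩ := exists_isLocal_of_family _ w hw
  refine ⟨Z', r, hr, fun {T} w' hw' X e m' he hem => ?_⟩
  obtain ⟨i, φ, rfl⟩ := hY e he
  -- The given extension shows that the quotient `q i` is among those taken care of by `r`.
  have hi : i ∈ S := ⟨T, w', φ.hom ≫ m', hw', by rw [← Category.assoc, hem]⟩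
  obtain ⟨l, rfl⟩ := hl ⟨i, hi⟩
  refine ⟨φ.inv ≫ m ⟨i, hi⟩ ≫ Hom.hom l, ?_⟩
  have := hm ⟨i, hi⟩
  simp [reassoc_of% this]

lemma isRightAdjoint_ι_of_boundedSizeCondition
    [MorphismProperty.IsSmall.{v} J] (hC : BoundedSizeCondition C) :
    (genericArrows J).isLocal.ι.IsRightAdjoint := by
  obtain ⟨E, M, hEM, hp, hE, hC⟩ := hC
  choose κ hκ hκ' using hC
  obtain ⟨κ', h, hle⟩ := exists_isRegular_forall_le (fun j : J.toSet => κ j.1.left)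
  have : Fact κ'.IsRegular := ⟨h⟩
  choose prep r hr hr' using exists_preparation (J := J) hE
  refine OrthogonalReflectionWithPreparation.isRightAdjoint_ι _ r hr κ'
    (fun F c hc hcW hF => isSmallFor hc fun {A B} j hj => ?_)
  refine .of_homPreservesUnions hEM hp κ' (isColimitOfPreserves (forget J) hc) (fun k => ?_)
    ((hκ' A).of_le (hle ⟨Arrow.mk j, hj⟩))
  obtain ⟨l, u, g, hg⟩ := hF k
  refine ⟨l, u, fun e m he hem => ?_⟩
  obtain ⟨t, ht⟩ := hr' (F.obj k) (c.ι.app k) (hcW k) e m he hem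
  refine ⟨t ≫ Hom.hom g, ?_⟩
  have h₁ : e ≫ t ≫ Hom.hom g = Hom.hom (r (F.obj k)) ≫ Hom.hom g :=
    (Category.assoc _ _ _).symm.trans (congrArg (· ≫ Hom.hom g) ht)
  exact h₁.trans (congrArg Hom.hom hg)

end PartInj

/-! ### The comparison functor -/

namespace AlgInj

variable {C : Type u} [Category.{v} C] {J : MorphismProperty C}

section Monadicity

variable {L : C ⥤ AlgInj J} (adj : L ⊣ forget J)

/-- The unit, as a morphism of `C` to the object underlying the free algebraic injective. -/
abbrev unitHom (X : C) : X ⟶ (L.obj X).obj := adj.unit.app X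

/-- The counit, as a morphism of `C` from the object underlying the free algebraic injective. -/
abbrev counitHom (Z : AlgInj J) : (L.obj Z.obj).obj ⟶ Z.obj := Hom.hom (adj.counit.app Z)

/-- In an algebra for the induced monad, the structure map commutes with the extensions which it
induces from those of the free algebraic injective. -/
lemma lift_comp_algebra_a (X : adj.toMonad.Algebra) {A B : C} (j : A ⟶ B) (hj : J j)
    (g : A ⟶ (L.obj X.A).obj) (a : (L.obj X.A).obj ⟶ X.A) (ha : a = X.a) :
    (L.obj X.A).lift j hj g ≫ a = (L.obj X.A).lift j hj ((g ≫ a) ≫ unitHom adj X.A) ≫ a := by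
  have assoc : counitHom adj (L.obj X.A) ≫ a = Hom.hom (L.map a) ≫ a := by
    subst ha
    exact X.assoc
  have nat : a ≫ unitHom adj X.A = unitHom adj (L.obj X.A).obj ≫ Hom.hom (L.map a) :=
    adj.unit.naturality a
  have tri : unitHom adj (L.obj X.A).obj ≫ counitHom adj (L.obj X.A) = 𝟙 _ :=
    adj.right_triangle_components (L.obj X.A)
  calc (L.obj X.A).lift j hj g ≫ a
      = (L.obj X.A).lift j hj
          ((g ≫ unitHom adj (L.obj X.A).obj) ≫ counitHom adj (L.obj X.A)) ≫ a := by
        rw [Category.assoc, tri, Category.comp_id]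
    _ = (L.obj (L.obj X.A).obj).lift j hj (g ≫ unitHom adj (L.obj X.A).obj) ≫
          counitHom adj (L.obj X.A) ≫ a := by
        rw [← Category.assoc]
        exact congrArg (· ≫ a) ((adj.counit.app (L.obj X.A)).comm j hj _).symm
    _ = ((L.obj (L.obj X.A).obj).lift j hj (g ≫ unitHom adj (L.obj X.A).obj) ≫
          Hom.hom (L.map a)) ≫ a := by rw [assoc, Category.assoc]
    _ = (L.obj X.A).lift j hj ((g ≫ unitHom adj (L.obj X.A).obj) ≫ Hom.hom (L.map a)) ≫ a :=
        congrArg (· ≫ a) ((L.map a).comm j hj _)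
    _ = _ := by rw [Category.assoc, Category.assoc, nat]

/-- The algebraic injective underlying an algebra for the induced monad: the extension of `f` is
obtained from the extension of `f ≫ η` in the free algebraic injective by the structure map. -/
@[simps]
def ofAlgebra (X : adj.toMonad.Algebra) : AlgInj J where
  obj := X.A
  lift j hj f := (L.obj X.A).lift j hj (f ≫ unitHom adj X.A) ≫ X.a
  fac j hj f := by
    have h : unitHom adj X.A ≫ X.a = 𝟙 X.A := X.unit
    have h' := congrArg (· ≫ X.a) ((L.obj X.A).fac j hj (f ≫ unitHom adj X.A))
    refine (Category.assoc _ _ _).symm.trans (h'.trans ?_)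
    exact (Category.assoc _ _ _).trans ((congrArg (f ≫ ·) h).trans (Category.comp_id f))

/-- Algebra morphisms are morphisms of the underlying algebraic injectives. -/
def ofAlgebraMap {X Y : adj.toMonad.Algebra} (h : X ⟶ Y) : ofAlgebra adj X ⟶ ofAlgebra adj Y where
  hom := h.f
  comm j hj f := by
    have h₁ : X.a ≫ h.f = Hom.hom (L.map h.f) ≫ Y.a := h.h.symm
    have h₂ : h.f ≫ unitHom adj Y.A = unitHom adj X.A ≫ Hom.hom (L.map h.f) :=
      adj.unit.naturality h.f
    have h₃ := (L.map h.f).comm j hj (f ≫ unitHom adj X.A)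
    calc ((L.obj X.A).lift j hj (f ≫ unitHom adj X.A) ≫ X.a) ≫ h.f
        = (L.obj X.A).lift j hj (f ≫ unitHom adj X.A) ≫ Hom.hom (L.map h.f) ≫ Y.a :=
          (Category.assoc _ _ _).trans (congrArg (_ ≫ ·) h₁)
      _ = (L.obj Y.A).lift j hj ((f ≫ unitHom adj X.A) ≫ Hom.hom (L.map h.f)) ≫ Y.a :=
          (Category.assoc _ _ _).symm.trans (congrArg (· ≫ Y.a) h₃)
      _ = (L.obj Y.A).lift j hj ((f ≫ h.f) ≫ unitHom adj Y.A) ≫ Y.a := by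
          refine congrArg (fun k => (L.obj Y.A).lift j hj k ≫ Y.a) ?_
          exact (Category.assoc _ _ _).trans
            ((congrArg (f ≫ ·) h₂.symm).trans (Category.assoc _ _ _).symm)

/-- The inverse of the comparison functor. -/
@[simps]
def ofAlgebraFunctor : adj.toMonad.Algebra ⥤ AlgInj J where
  obj := ofAlgebra adj
  map := ofAlgebraMap adj
  map_id _ := rfl
  map_comp _ _ := rfl

/-- Algebraic injectives on the same object with the same extensions are equal. -/
lemma mk_eq {X : C} {l l' : ∀ {A B : C} (j : A ⟶ B), J j → (A ⟶ X) → (B ⟶ X)}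
    {h : ∀ {A B : C} (j : A ⟶ B) (hj : J j) (f : A ⟶ X), j ≫ l j hj f = f}
    {h' : ∀ {A B : C} (j : A ⟶ B) (hj : J j) (f : A ⟶ X), j ≫ l' j hj f = f}
    (e : ∀ {A B : C} (j : A ⟶ B) (hj : J j) (f : A ⟶ X), l j hj f = l' j hj f) :
    (⟨X, l, h⟩ : AlgInj J) = ⟨X, l', h'⟩ := by
  obtain rfl : @l = @l' := by
    funext A B j hj f
    exact e j hj f
  rfl

lemma ofAlgebra_comparison_obj (Z : AlgInj J) :
    ofAlgebra adj ((Monad.comparison adj).obj Z) = Z := by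
  have h : ∀ {A B : C} (j : A ⟶ B) (hj : J j) (f : A ⟶ Z.obj),
      (L.obj Z.obj).lift j hj (f ≫ unitHom adj Z.obj) ≫ counitHom adj Z = Z.lift j hj f := by
    intro A B j hj f
    have tri : unitHom adj Z.obj ≫ counitHom adj Z = 𝟙 _ := adj.right_triangle_components Z
    refine ((adj.counit.app Z).comm j hj _).trans (congrArg (Z.lift j hj) ?_)
    exact (Category.assoc _ _ _).trans ((congrArg (f ≫ ·) tri).trans (Category.comp_id f))
  exact mk_eq (l := fun j hj f => (L.obj Z.obj).lift j hj (f ≫ unitHom adj Z.obj) ≫ counitHom adj Z)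
    (l' := fun j hj f => Z.lift j hj f)
    (h := (ofAlgebra adj ((Monad.comparison adj).obj Z)).fac) (h' := Z.fac) h

/-- The structure map of an algebra is a morphism from the free algebraic injective, hence it is the
counit at the underlying algebraic injective. -/
lemma counitHom_ofAlgebra (X : adj.toMonad.Algebra) :
    counitHom adj (ofAlgebra adj X) = X.a := by
  let α : L.obj X.A ⟶ ofAlgebra adj X :=
    { hom := X.a
      comm := fun j hj g => lift_comp_algebra_a adj X j hj g X.a rfl }
  have h : adj.counit.app (ofAlgebra adj X) = α := by
    refine (adj.homEquiv X.A (ofAlgebra adj X)).injective ?_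
    refine (adj.homEquiv_unit _ _ _).trans (Eq.trans ?_ (adj.homEquiv_unit _ _ _).symm)
    exact (adj.right_triangle_components (ofAlgebra adj X)).trans X.unit.symm
  exact congrArg Hom.hom h

lemma comparison_obj_ofAlgebra (X : adj.toMonad.Algebra) :
    (Monad.comparison adj).obj (ofAlgebra adj X) = X := by
  have h := counitHom_ofAlgebra adj X
  obtain ⟨A, a, hu, ha⟩ := X
  dsimp only [Monad.comparison]
  congr 1

lemma eqToHom_hom {X Y : AlgInj J} (h : X = Y) (g : X.obj ⟶ Y.obj) (hg : g ≍ 𝟙 X.obj) :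
    Hom.hom (eqToHom h) = g := by
  subst h
  exact (eq_of_heq hg).symm

lemma algebra_eqToHom_f {T : Monad C} {X Y : T.Algebra} (h : X = Y) (g : X.A ⟶ Y.A)
    (hg : g ≍ 𝟙 X.A) : (eqToHom h).f = g := by
  subst h
  exact (eq_of_heq hg).symm

lemma isCategoryIso_comparison : IsCategoryIso (Monad.comparison adj) := by
  refine ⟨ofAlgebraFunctor adj,
    CategoryTheory.Functor.ext (ofAlgebra_comparison_obj adj) fun X Y f => hom_ext ?_,
    CategoryTheory.Functor.ext (comparison_obj_ofAlgebra adj) fun X Y f =>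
      Monad.Algebra.Hom.ext ?_⟩
  · have h₁ := eqToHom_hom (ofAlgebra_comparison_obj adj X) (𝟙 X.obj) HEq.rfl
    have h₂ := eqToHom_hom (ofAlgebra_comparison_obj adj Y).symm (𝟙 Y.obj) HEq.rfl
    have h : Hom.hom f = 𝟙 X.obj ≫ Hom.hom f ≫ 𝟙 Y.obj := by simp
    exact h.trans (congrArg₂ (fun a b => a ≫ Hom.hom f ≫ b) h₁.symm h₂.symm)
  · have h₁ := algebra_eqToHom_f (comparison_obj_ofAlgebra adj X) (𝟙 X.A) HEq.rfl
    have h₂ := algebra_eqToHom_f (comparison_obj_ofAlgebra adj Y).symm (𝟙 Y.A) HEq.rfl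
    have h : f.f = 𝟙 X.A ≫ f.f ≫ 𝟙 Y.A := by simp
    exact h.trans (congrArg₂ (fun a b => a ≫ f.f ≫ b) h₁.symm h₂.symm)

end Monadicity

end AlgInj

/-! ### Local presentability -/

/-- The image of a strong generator under the left adjoint of a faithful conservative functor is a
strong generator. -/
lemma isStrongGenerator_strictMap {C : Type u₁} [Category.{v₁} C] {D : Type u₂} [Category.{v₂} D]
    {F : C ⥤ D} {G : D ⥤ C} (adj : F ⊣ G) [G.Faithful] [G.ReflectsIsomorphisms]
    {P : ObjectProperty C} (hP : P.IsStrongGenerator) : (P.strictMap F).IsStrongGenerator := by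
  rw [ObjectProperty.isStrongGenerator_iff]
  refine ⟨fun X Y f g h => G.map_injective (hP.isSeparating _ _ fun A hA a => ?_),
    fun X Y i _ h => ?_⟩
  · have := h (F.obj A) ⟨A, hA⟩ ((adj.homEquiv _ _).symm a)
    simpa [Adjunction.homEquiv_naturality_right] using congrArg (adj.homEquiv _ _) this
  · have := adj.rightAdjoint_preservesLimits
    have : IsIso (G.map i) := by
      refine hP.isIso_of_mono _ fun A hA a => ?_
      obtain ⟨b, hb⟩ := h (F.obj A) ⟨A, hA⟩ ((adj.homEquiv _ _).symm a)
      refine ⟨adj.homEquiv _ _ b, ?_⟩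
      have := congrArg (adj.homEquiv _ _) hb
      simpa [Adjunction.homEquiv_naturality_right] using this
    exact isIso_of_reflects_iso i G

/-- A cocomplete category with a faithful conservative accessible right adjoint to a locally
presentable category is locally presentable. -/
lemma isCardinalLocallyPresentable_of_adjunction {C : Type u₁} [Category.{v₁} C] {D : Type u₂}
    [Category.{v₂} D] {F : C ⥤ D} {G : D ⥤ C} (adj : F ⊣ G) [G.Faithful]
    [G.ReflectsIsomorphisms] (κ : Cardinal.{v}) [Fact κ.IsRegular] [G.IsCardinalAccessible κ]
    [IsCardinalLocallyPresentable C κ] [HasColimitsOfSize.{v, v} D] :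
    IsCardinalLocallyPresentable D κ := by
  have : LocallySmall.{v} D := locallySmall_of_faithful G
  obtain ⟨P, _, hP, hP'⟩ :=
    (IsCardinalLocallyPresentable.iff_exists_isStrongGenerator C κ).1 inferInstance
  refine (IsCardinalLocallyPresentable.iff_exists_isStrongGenerator D κ).2
    ⟨P.strictMap F, inferInstance, isStrongGenerator_strictMap adj hP, ?_⟩
  rintro _ ⟨X, hX⟩
  have : IsCardinalPresentable X κ := hP' X hX
  exact adj.isCardinalPresentable_leftAdjoint_obj κ X

namespace PartInj

variable {C : Type u} [Category.{v} C] {J : MorphismProperty C}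

/-- If the domains of the morphisms in `J` are `κ`-presentable, local objects are closed under
`κ`-filtered colimits, so that their inclusion is accessible. -/
lemma isCardinalAccessible_ι [HasColimitsOfSize.{v, v} C] (κ : Cardinal.{v}) [Fact κ.IsRegular]
    (hκ : ∀ {A B : C} (j : A ⟶ B), J j → IsCardinalPresentable A κ) :
    (genericArrows J).isLocal.ι.IsCardinalAccessible κ where
  preservesColimitOfShape K _ _ := by
    have : (genericArrows J).isLocal.IsClosedUnderColimitsOfShape K :=
      { colimitsOfShape_le := fun Z ⟨p⟩ => by
          have := isFiltered_of_isCardinalFiltered K κ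
          refine (isSmallFor p.isColimit fun {A B} j hj => ?_).isLocal_pt _ p.prop_diag_obj
          have := hκ j hj
          exact .of_isCardinalAccessible κ (isColimitOfPreserves (forget J) p.isColimit) A }
    infer_instance

end PartInj

namespace AlgInj

variable {C : Type u} [Category.{v} C] {J : MorphismProperty C}

instance : (forget J).Faithful where
  map_injective h := hom_ext h

instance : (forget J).ReflectsIsomorphisms where
  reflects {X Y} f hf := by
    obtain ⟨g, hfg, hgf⟩ := hf
    let g : Y.obj ⟶ X.obj := g
    change Hom.hom f ≫ g = 𝟙 X.obj at hfg
    change g ≫ Hom.hom f = 𝟙 Y.obj at hgf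
    have hcomm : ∀ {A B : C} (j : A ⟶ B) (hj : J j) (a : A ⟶ Y.obj),
        Y.lift j hj a ≫ g = X.lift j hj (a ≫ g) := by
      intro A B j hj a
      have h := f.comm j hj (a ≫ g)
      rw [Category.assoc, hgf, Category.comp_id] at h
      rw [← h, Category.assoc, hfg, Category.comp_id]
    exact ⟨{ hom := g, comm := hcomm }, hom_ext hfg, hom_ext hgf⟩

section

variable [(PartInj.genericArrows J).isLocal.ι.IsRightAdjoint]

instance : (toPartInj J).IsRightAdjoint :=
  inferInstanceAs (toLocal J ⋙ (PartInj.genericArrows J).isLocal.ι).IsRightAdjoint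

instance : (forget J).IsRightAdjoint :=
  inferInstanceAs (toPartInj J ⋙ PartInj.forget J).IsRightAdjoint

/-- Algebraic injectives are reflective in partial algebraic injectives, so they inherit
colimits. -/
lemma hasColimitsOfSize [HasColimitsOfSize.{v, v} C] : HasColimitsOfSize.{v, v} (AlgInj J) :=
  letI : Reflective (toPartInj J) := ⟨_, Adjunction.ofIsRightAdjoint _⟩
  hasColimits_of_reflective (toPartInj J)

end

lemma isCardinalAccessible_forget [HasColimitsOfSize.{v, v} C] (κ : Cardinal.{v})
    [Fact κ.IsRegular] (hκ : ∀ {A B : C} (j : A ⟶ B), J j → IsCardinalPresentable A κ) :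
    (forget J).IsCardinalAccessible κ where
  preservesColimitOfShape K _ _ := by
    have := PartInj.isCardinalAccessible_ι (J := J) κ hκ
    have := (PartInj.genericArrows J).isLocal.ι.preservesColimitsOfShape_of_isCardinalAccessible κ K
    exact inferInstanceAs (PreservesColimitsOfShape K
      ((toLocal J ⋙ (PartInj.genericArrows J).isLocal.ι) ⋙ PartInj.forget J))

end AlgInj

theorem mainTheorem5 {C : Type u} [Category.{v} C] [HasColimitsOfSize.{v, v} C]
    (J : MorphismProperty C) [MorphismProperty.IsSmall.{v} J]
    (hC : PresentableSizeCondition C ∨ BoundedSizeCondition C) :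
    ((AlgInj.forget J).IsRightAdjoint ∧ IsStrictlyMonadic (AlgInj.forget J)) ∧
      (IsLocallyPresentable.{v} C →
        IsLocallyPresentable.{v} (AlgInj J) ∧ Functor.IsAccessible.{v} (AlgInj.forget J)) := by
  have : (PartInj.genericArrows J).isLocal.ι.IsRightAdjoint :=
    hC.elim PartInj.isRightAdjoint_ι_of_presentableSizeCondition
      PartInj.isRightAdjoint_ι_of_boundedSizeCondition
  have hU : (AlgInj.forget J).IsRightAdjoint := inferInstance
  refine ⟨⟨hU, hU, fun L adj => AlgInj.isCategoryIso_comparison adj⟩, fun hlp => ?_⟩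
  obtain ⟨κ, hκ, hκC⟩ := hlp.exists_cardinal
  choose κ₁ hκ₁ hκ₁' using fun A : C => (inferInstance : IsPresentable.{v} A).exists_cardinal
  obtain ⟨κ₂, hκ₂, hle⟩ :=
    exists_isRegular_forall_le (Sum.elim (fun _ : Unit => κ) fun j : J.toSet => κ₁ j.1.left)
  have : Fact κ₂.IsRegular := ⟨hκ₂⟩
  have : IsCardinalLocallyPresentable C κ₂ :=
    have h : κ ≤ κ₂ := hle (.inl ())
    .of_le C h
  have hA : ∀ {A B : C} (j : A ⟶ B), J j → IsCardinalPresentable A κ₂ := fun {A B} j hj =>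
    have h : κ₁ A ≤ κ₂ := hle (.inr ⟨Arrow.mk j, hj⟩)
    have := hκ₁' A
    isCardinalPresentable_of_le A h
  have := AlgInj.isCardinalAccessible_forget κ₂ hA
  have := AlgInj.hasColimitsOfSize (J := J)
  exact ⟨⟨κ₂, inferInstance, isCardinalLocallyPresentable_of_adjunction
    (Adjunction.ofIsRightAdjoint (AlgInj.forget J)) κ₂⟩,
    Functor.isAccessible_of_isCardinalAccessible _ κ₂⟩
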